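/- Let $S$ be a Polish space with metric $d$ and Borel $\sigma$-algebra, let $\mathcal P(S)$ be the set of Borel probability measures on $S$, and let $c:S\times S\to[0,\infty]$ be symmetric, $c(x,y)=c(y,x)$. Put $$\mathrm{Lip}(c,S)=\{f:S\to\mathbb R \text{ continuous}: f(x)-f(y)\le c(x,y)\ \text{for all } x,y\in S\},$$ and let $\Gamma=\mathrm{Lip}(c,S;C_b(S))$ be the set of bounded functions in $\mathrm{Lip}(c,S)$. For $\mu,\nu,\gamma\in\mathcal P(S)$ define $$G(\mu\|\nu)=\sup_{g\in\Gamma}\Big\{\int_S g\,d\mu-\log\int_S e^g\,d\nu\Big\},\qquad W_c(\mu,\gamma)=\sup_{g\in\Gamma}\int_S g\,d(\mu-\gamma),$$ and let $R(\gamma\|\nu)$ be the relative entropy, $R(\gamma\|\nu)=\int_S\log\frac{d\gamma}{d\nu}\,d\gamma$ if $\gamma\ll\nu$ and $R(\gamma\|\nu)=\infty$ otherwise. Assume: 1. there is a nonempty set $Q$ of bounded continuous functions on $S$ with $c(x,y)=\sup_{u\in Q}(u(x)-u(y))$ for all $x,y\in S$; 2. $\Gamma$ is measure determining: for all $\theta_1\ne\theta_2$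 in $\mathcal P(S)$ there is $f\in\Gamma$ with $\int_S f\,d\theta_1\neq\int_S f\,d\theta_2$; 3. there is $a:S\to[0,\infty)$ with $c(x,y)\le a(x)+a(y)$ for all $x,y\in S$; 4. there are compact sets $K_m\subset S$, $m\in\mathbb N$, with $K_m\subset K_{m+1}$ and $\bigcup_m K_m=S$, and for each $m$ a function $\theta_m:[0,\infty)\to[0,\infty)$ with $\lim_{t\to0}\theta_m(t)=0$ and a number $\delta_m>0$ such that $c(x,y)\le\theta_m(d(x,y))$ for all $x,y\in K_m$ with $d(x,y)\le\delta_m$. Let $\mu,\nu\in\mathcal P(S)$ satisfy $\int_S a\,d\mu<\infty$ and $\int_S a\,d\nu<\infty$. Suppose that $g_1\in\mathrm{Lip}(c,S)$ and $\gamma_1\in\mathcal P(S)$ with $\gamma_1\ll\nu$ satisfy $$\text{(i)}\quad \frac{d\gamma_1}{d\nu}(x)=\frac{e^{g_1(x)}}{\int_S e^{g_1}\,d\nu}\quad\text{for } \nu\text{-a.e. }x,\qquad\qquad \text{(ii)}\quad W_c(\mu,\gamma_1)=\int_S g_1\,d(\mu-\gamma_1).$$ Then $(g_1,\gamma_1)$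 is an optimal pair for the variational problem $$G(\mu\|\nu)=\sup_{g\in\Gamma}\Big\{\int_S g\,d\mu-\log\int_S e^g\,d\nu\Big\}=\inf_{\gamma\in\mathcal P(S)}\big\{W_c(\mu,\gamma)+R(\gamma\|\nu)\big\},$$ that is, $g_1$ is $\mu$-integrable, $e^{g_1}$ is $\nu$-integrable, and $$G(\mu\|\nu)=\int_S g_1\,d\mu-\log\int_S e^{g_1}\,d\nu=W_c(\mu,\gamma_1)+R(\gamma_1\|\nu)=\inf_{\gamma\in\mathcal P(S)}\big\{W_c(\mu,\gamma)+R(\gamma\|\nu)\big\}.$$ -/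

import Mathlib

open MeasureTheory Filter Topology
open scoped BoundedContinuousFunction ENNReal NNReal

namespace GammaDivergence

noncomputable section

/-- `Lip(c, S; C_b(S))`: bounded continuous `f` with `f x - f y ≤ c x y` for all `x, y`. -/
def lipCb {S : Type*} [TopologicalSpace S] (c : S → S → ℝ≥0∞) : Set (S →ᵇ ℝ) :=
  {f | ∀ x y, ((f x - f y : ℝ) : EReal) ≤ (c x y : EReal)}

/-- `Lip(c, S)`: continuous, possibly unbounded `f` with `f x - f y ≤ c x y` for all `x, y`. -/
def lipC {S : Type*} [TopologicalSpace S] (c : S → S → ℝ≥0∞) : Set C(S, ℝ) :=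
  {f | ∀ x y, ((f x - f y : ℝ) : EReal) ≤ (c x y : EReal)}

/-- The cost is a supremum of differences `u x - u y` over a nonempty set of bounded continuous
functions `u`. -/
def HasSupRepresentation {S : Type*} [TopologicalSpace S] (c : S → S → ℝ≥0∞) : Prop :=
  ∃ Q : Set (S →ᵇ ℝ), Q.Nonempty ∧
    ∀ x y, (c x y : EReal) = ⨆ u ∈ Q, ((u x - u y : ℝ) : EReal)

/-- `Lip(c, S; C_b(S))` is measure determining. -/
def IsMeasureDetermining {S : Type*} [TopologicalSpace S] [MeasurableSpace S]
    (c : S → S → ℝ≥0∞) : Prop :=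
  ∀ θ₁ θ₂ : ProbabilityMeasure S, θ₁ ≠ θ₂ →
    ∃ f ∈ lipCb c, ∫ x, f x ∂(θ₁ : Measure S) ≠ ∫ x, f x ∂(θ₂ : Measure S)

/-- `S` is the union of an increasing sequence of compact sets, on each of which `c x y` is
controlled, at small distances, by a modulus of the distance that vanishes at `0`. -/
def HasLocalModulus {S : Type*} [MetricSpace S] (c : S → S → ℝ≥0∞) : Prop :=
  ∃ K : ℕ → Set S, (∀ m, IsCompact (K m)) ∧ (∀ m, K m ⊆ K (m + 1)) ∧ (⋃ m, K m) = Set.univ ∧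
    ∀ m, ∃ θ : ℝ≥0 → ℝ≥0, Tendsto θ (𝓝[≠] 0) (𝓝 0) ∧ ∃ δ : ℝ, 0 < δ ∧
      ∀ x ∈ K m, ∀ y ∈ K m, dist x y ≤ δ → c x y ≤ (θ (nndist x y) : ℝ≥0∞)

/-- `W_c(μ, γ)`, the supremum of `∫ g d(μ - γ)` over `g ∈ Lip(c, S; C_b(S))`. -/
def W {S : Type*} [TopologicalSpace S] [MeasurableSpace S] (c : S → S → ℝ≥0∞)
    (μ γ : Measure S) : EReal :=
  ⨆ g ∈ lipCb c, ((∫ x, g x ∂μ - ∫ x, g x ∂γ : ℝ) : EReal)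

/-- Relative entropy `R(γ ‖ ν)` of probability measures. -/
def R {S : Type*} [MeasurableSpace S] (γ ν : Measure S) : EReal :=
  (InformationTheory.klDiv γ ν : EReal)

/-- The `Γ`-divergence `G(μ ‖ ν)` for `Γ = Lip(c, S; C_b(S))`. -/
def G {S : Type*} [TopologicalSpace S] [MeasurableSpace S] (c : S → S → ℝ≥0∞)
    (μ ν : Measure S) : EReal :=
  ⨆ g ∈ lipCb c, ((∫ x, g x ∂μ - Real.log (∫ x, Real.exp (g x) ∂ν) : ℝ) : EReal)

end

end GammaDivergence

/-! Weak duality splits `∫ g dμ - log ∫ e^g dν` as `(∫ g dμ - ∫ g dγ) + (∫ g dγ - log ∫ e^g dν)`, at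
most `W + R` by Donsker–Varadhan (`G_le_W_add_R`). For `γ₁ ∝ e^{g₁} ν` the entropy is exactly `∫ g₁
dγ₁ - log ∫ e^{g₁} dν` (`R_tilted_self`), so by (ii) `W + R` at `γ₁` is the dual functional at `g₁`.
Truncating `g₁` bounds that value by `G` (`integral_sub_log_integral_exp_le_G`), and all
inequalities become equalities. The delicate point is the `γ₁`-integrability of `g₁`, which (ii)
does not grant, since a Bochner integral may be the default `0`. It is recovered from the finiteness
of `W`. -/

namespace GammaDivergence

/-! ### Clamping functions in `Lip(c, S)`. -/

section Truncation

variable {S : Type*} [TopologicalSpace S]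

/-- Truncation of a continuous function to the interval `[-l, r]`. -/
def truncate (l r : ℝ≥0) (f : C(S, ℝ)) : S →ᵇ ℝ :=
  BoundedContinuousFunction.ofNormedAddCommGroup (fun x => max (-(l : ℝ)) (min (f x) r))
    (by fun_prop) (max (l : ℝ) r) (fun x => by
      rw [Real.norm_eq_abs, abs_le]
      have hl := l.2
      have hr := r.2
      refine ⟨(neg_le_neg (le_max_left _ _)).trans (le_max_left _ _), max_le ?_ ?_⟩
      · exact (by linarith [l.coe_nonneg] : -(l : ℝ) ≤ l).trans (le_max_left _ _)
      · exact (min_le_right _ _).trans (le_max_right _ _))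

lemma truncate_apply (l r : ℝ≥0) (f : C(S, ℝ)) (x : S) :
    truncate l r f x = max (-(l : ℝ)) (min (f x) r) := rfl

lemma truncate_le_max_zero (l r : ℝ≥0) (f : C(S, ℝ)) (x : S) :
    truncate l r f x ≤ max (f x) 0 := by
  rw [truncate_apply]
  exact max_le ((neg_nonpos.2 l.coe_nonneg).trans (le_max_right _ _))
    ((min_le_left _ _).trans (le_max_left _ _))

lemma abs_truncate_le (l r : ℝ≥0) (f : C(S, ℝ)) (x : S) : |truncate l r f x| ≤ |f x| := by
  have hl := l.coe_nonneg
  have hr := r.coe_nonneg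
  rw [truncate_apply, abs_le]
  refine ⟨le_max_of_le_right (le_min (neg_abs_le _) (by linarith [abs_nonneg (f x)])),
    max_le (by linarith [abs_nonneg (f x)]) ((min_le_left _ _).trans (le_abs_self _))⟩

lemma tendsto_truncate (f : C(S, ℝ)) (x : S) :
    Tendsto (fun n : ℕ => truncate n n f x) atTop (𝓝 (f x)) := by
  obtain ⟨N, hN⟩ := exists_nat_ge |f x|
  refine tendsto_const_nhds.congr' ?_
  filter_upwards [eventually_ge_atTop N] with n hn
  have h : |f x| ≤ n := hN.trans (by exact_mod_cast hn)
  rw [abs_le] at h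
  rw [truncate_apply, NNReal.coe_natCast, min_eq_left h.2, max_eq_right h.1]

lemma tendsto_truncate_zero (f : C(S, ℝ)) (x : S) :
    Tendsto (fun n : ℕ => truncate 0 n f x) atTop (𝓝 (max (f x) 0)) := by
  obtain ⟨N, hN⟩ := exists_nat_ge (f x)
  refine tendsto_const_nhds.congr' ?_
  filter_upwards [eventually_ge_atTop N] with n hn
  have h : f x ≤ n := hN.trans (by exact_mod_cast hn)
  rw [truncate_apply, NNReal.coe_natCast, min_eq_left h, max_comm, NNReal.coe_zero, neg_zero]

variable {c : S → S → ℝ≥0∞}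

/-- Clamping is monotone and 1-Lipschitz on `ℝ`, so each increment is at most its own positive part;
then `c ≥ 0` suffices. -/
lemma truncate_mem_lipCb {f : C(S, ℝ)} (hf : f ∈ lipC c) (l r : ℝ≥0) :
    truncate l r f ∈ lipCb c := by
  intro x y
  have key : truncate l r f x - truncate l r f y ≤ max (f x - f y) 0 := by
    simp only [truncate_apply]
    rcases le_total (f x) (f y) with h | h
    · exact le_max_of_le_right
        (sub_nonpos.2 (max_le_max le_rfl (min_le_min h le_rfl)))
    · refine le_max_of_le_left ?_
      rw [sub_le_iff_le_add]
      refine max_le ?_ ?_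
      · linarith [le_max_left (-(l : ℝ)) (min (f y) r)]
      · have h1 : min (f x) r ≤ f x - f y + min (f y) r := by
          rw [← min_add_add_left]
          exact le_min ((min_le_left _ _).trans (by linarith))
            ((min_le_right _ _).trans (by linarith))
        linarith [le_max_right (-(l : ℝ)) (min (f y) r)]
  refine (EReal.coe_le_coe_iff.2 key).trans ?_
  rcases max_choice (f x - f y) 0 with h | h
  · rw [h]; exact hf x y
  · rw [h]; exact EReal.coe_ennreal_nonneg _

lemma neg_mem_lipCb (hsymm : ∀ x y, c x y = c y x) {f : S →ᵇ ℝ} (hf : f ∈ lipCb c) :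
    -f ∈ lipCb c := by
  intro x y
  have h := hf y x
  rw [hsymm y x] at h
  refine le_of_eq_of_le ?_ h
  congr 1
  simp only [BoundedContinuousFunction.coe_neg, Pi.neg_apply]
  ring

lemma sub_le_of_mem_lipC {a : S → ℝ≥0} (hca : ∀ x y, c x y ≤ (a x : ℝ≥0∞) + (a y : ℝ≥0∞))
    {f : C(S, ℝ)} (hf : f ∈ lipC c) (x y : S) : f x - f y ≤ a x + a y := by
  have h := (hf x y).trans (EReal.coe_ennreal_le_coe_ennreal_iff.2 (hca x y))
  rw [← ENNReal.coe_add, EReal.coe_nnreal_eq_coe_real, EReal.coe_le_coe_iff] at h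
  exact_mod_cast h

end Truncation

/-! ### Integrability under `μ` and under the tilted measure. -/

section Measure

variable {S : Type*} [TopologicalSpace S] [MeasurableSpace S] [BorelSpace S] {c : S → S → ℝ≥0∞}

/-- Comparison with a base point `x₀` gives `|f x| ≤ a x + a x₀ + |f x₀|`. -/
lemma integrable_of_mem_lipC {a : S → ℝ≥0}
    (hca : ∀ x y, c x y ≤ (a x : ℝ≥0∞) + (a y : ℝ≥0∞)) {μ : Measure S} [IsProbabilityMeasure μ]
    (hμ : ∫⁻ x, (a x : ℝ≥0∞) ∂μ < ∞) {f : C(S, ℝ)} (hf : f ∈ lipC c) :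
    Integrable (fun x => f x) μ := by
  obtain ⟨x₀⟩ := nonempty_of_isProbabilityMeasure μ
  refine ⟨f.continuous.measurable.aestronglyMeasurable, ?_⟩
  have hle : ∀ x, ‖f x‖ₑ ≤ (a x : ℝ≥0∞) + ((a x₀ + ‖f x₀‖₊ : ℝ≥0) : ℝ≥0∞) := by
    intro x
    rw [enorm_eq_nnnorm, ← ENNReal.coe_add, ENNReal.coe_le_coe, ← NNReal.coe_le_coe]
    push_cast
    rw [Real.norm_eq_abs, Real.norm_eq_abs, abs_le]
    have h1 := sub_le_of_mem_lipC hca hf x x₀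
    have h2 := sub_le_of_mem_lipC hca hf x₀ x
    constructor <;> linarith [le_abs_self (f x₀), neg_abs_le (f x₀)]
  refine (lintegral_mono hle).trans_lt ?_
  rw [lintegral_add_right _ measurable_const]
  simpa using hμ

/-- A function `f` is integrable for the exponentially tilted measure `γ ∝ e^f ν` as soon as its
truncated positive parts have bounded integrals. -/
lemma integrable_tilted_self {ν : Measure S} [IsProbabilityMeasure ν] {f : C(S, ℝ)}
    (hexp : Integrable (fun x => Real.exp (f x)) ν) {M : ℝ}
    (hM : ∀ n : ℕ, ∫ x, truncate 0 n f x ∂(ν.tilted f) ≤ M) :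
    Integrable (fun x => f x) (ν.tilted f) := by
  have := isProbabilityMeasure_tilted hexp
  -- Fatou's lemma along the truncations at height `n`.
  have hpos : Integrable (fun x => max (f x) 0) (ν.tilted f) := by
    refine ⟨(f.continuous.max continuous_const).measurable.aestronglyMeasurable, ?_⟩
    have hmeas : ∀ n : ℕ, Measurable fun x => ‖truncate 0 n f x‖ₑ := fun n =>
      (truncate 0 n f).continuous.measurable.enorm
    have hlim : ∀ x, liminf (fun n : ℕ => ‖truncate 0 n f x‖ₑ) atTop = ‖max (f x) 0‖ₑ :=
      fun x => (tendsto_truncate_zero f x).enorm.liminf_eq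
    have hbound : ∀ n : ℕ, ∫⁻ x, ‖truncate 0 n f x‖ₑ ∂(ν.tilted f) ≤ ENNReal.ofReal M := by
      intro n
      have h0 : ∀ x, 0 ≤ truncate 0 n f x := fun x => by simp [truncate_apply]
      simp_rw [fun x => Real.enorm_of_nonneg (h0 x)]
      rw [← ofReal_integral_eq_lintegral_ofReal ((truncate 0 n f).integrable _) (ae_of_all _ h0)]
      exact ENNReal.ofReal_le_ofReal (hM n)
    calc ∫⁻ x, ‖max (f x) 0‖ₑ ∂(ν.tilted f)
        = ∫⁻ x, liminf (fun n : ℕ => ‖truncate 0 n f x‖ₑ) atTop ∂(ν.tilted f) := by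
          simp_rw [hlim]
      _ ≤ liminf (fun n : ℕ => ∫⁻ x, ‖truncate 0 n f x‖ₑ ∂(ν.tilted f)) atTop :=
          lintegral_liminf_le hmeas
      _ ≤ ENNReal.ofReal M := by
          refine liminf_le_of_le (by isBoundedDefault) fun b hb => ?_
          obtain ⟨n, hn⟩ := hb.exists
          exact hn.trans (hbound n)
      _ < ∞ := ENNReal.ofReal_lt_top
  -- The negative part needs no hypothesis on `W`: its product with the density is controlled by
  -- `e^t * max (-t) 0 ≤ 1`.
  have hneg : Integrable (fun x => max (-f x) 0) (ν.tilted f) := by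
    rw [integrable_tilted_iff hexp]
    refine Integrable.of_bound (C := 1) ?_ (ae_of_all _ fun x => ?_)
    · exact (by fun_prop : Continuous fun x => Real.exp (f x) • max (-f x) 0).measurable
        |>.aestronglyMeasurable
    · rw [smul_eq_mul, Real.norm_of_nonneg (by positivity)]
      have h1 : max (-f x) 0 ≤ Real.exp (-f x) :=
        max_le (by linarith [Real.add_one_le_exp (-f x)]) (Real.exp_pos _).le
      calc Real.exp (f x) * max (-f x) 0 ≤ Real.exp (f x) * Real.exp (-f x) := by gcongr
        _ = 1 := by rw [← Real.exp_add, add_neg_cancel, Real.exp_zero]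
  refine (hpos.sub hneg).congr (ae_of_all _ fun x => ?_)
  rcases le_total (f x) 0 with h | h
  · simp [h]
  · simp [h]

/-- If the density of a probability measure is the normalised exponential of `f`, then `e^f` is
integrable and the measure is the exponential tilting by `f`. -/
lemma eq_tilted_of_rnDeriv {α : Type*} [MeasurableSpace α] {γ ν : Measure α}
    [IsProbabilityMeasure γ] [IsProbabilityMeasure ν] (hac : γ ≪ ν) {f : α → ℝ}
    (hdens : γ.rnDeriv ν =ᵐ[ν]
      fun x => ENNReal.ofReal (Real.exp (f x) / ∫ y, Real.exp (f y) ∂ν)) :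
    Integrable (fun x => Real.exp (f x)) ν ∧ γ = ν.tilted f := by
  have h : γ = ν.tilted f := by
    rw [← Measure.withDensity_rnDeriv_eq γ ν hac, withDensity_congr_ae hdens, Measure.tilted]
  refine ⟨?_, h⟩
  -- Were `e^f` not integrable, the normalising integral would default to `0` and the tilted measure
  -- would vanish.
  by_contra hexp
  exact IsProbabilityMeasure.ne_zero γ (h.trans (tilted_of_not_integrable hexp))

/-! ### Relative entropy and exponential tilting. -/

lemma R_tilted_self {α : Type*} [MeasurableSpace α] {ν : Measure α} [IsProbabilityMeasure ν]
    {f : α → ℝ}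
    (hexp : Integrable (fun x => Real.exp (f x)) ν)
    (hint : Integrable (fun x => f x) (ν.tilted f)) :
    R (ν.tilted f) ν =
      ((∫ x, f x ∂(ν.tilted f) - Real.log (∫ x, Real.exp (f x) ∂ν) : ℝ) : EReal) := by
  have := isProbabilityMeasure_tilted hexp
  have hac := tilted_absolutelyContinuous ν f
  have hllr : llr (ν.tilted f) ν =ᵐ[ν.tilted f]
      fun x => f x - Real.log (∫ x, Real.exp (f x) ∂ν) :=
    hac.ae_le (log_rnDeriv_tilted_left_self hexp)
  have hi : Integrable (llr (ν.tilted f) ν) (ν.tilted f) :=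
    (hint.sub (integrable_const _)).congr hllr.symm
  have htop := InformationTheory.klDiv_ne_top hac hi
  rw [R, ← EReal.coe_ennreal_toReal htop,
    InformationTheory.toReal_klDiv_of_measure_eq hac (by simp), integral_congr_ae hllr,
    integral_sub hint (integrable_const _)]
  simp

/-- The easy half of the Donsker–Varadhan variational formula. -/
lemma integral_sub_log_integral_exp_le_R {γ ν : Measure S} [IsProbabilityMeasure γ]
    [IsProbabilityMeasure ν] (g : S →ᵇ ℝ) :
    ((∫ x, g x ∂γ - Real.log (∫ x, Real.exp (g x) ∂ν) : ℝ) : EReal) ≤ R γ ν := by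
  by_cases htop : InformationTheory.klDiv γ ν = ∞
  · simp [R, htop]
  obtain ⟨hac, hi⟩ := InformationTheory.klDiv_ne_top_iff.1 htop
  have hexp : Integrable (fun x => Real.exp (g x)) ν := by
    refine Integrable.of_bound (C := Real.exp ‖g‖)
      (by fun_prop : Continuous fun x => Real.exp (g x)).measurable.aestronglyMeasurable
      (ae_of_all _ fun x => ?_)
    rw [Real.norm_of_nonneg (Real.exp_pos _).le]
    exact Real.exp_le_exp.2 ((le_abs_self _).trans (g.norm_coe_le_norm x))
  have := isProbabilityMeasure_tilted hexp
  -- Gibbs' inequality: the entropy of `γ` relative to `ν` tilted by `g` is nonnegative.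
  have hnonneg := InformationTheory.integral_llr_add_sub_measure_univ_nonneg
    (hac.trans (absolutelyContinuous_tilted hexp))
    (integrable_llr_tilted_right hac (g.integrable γ) hi hexp)
  rw [integral_llr_tilted_right hac (g.integrable γ) hexp hi] at hnonneg
  rw [R, ← EReal.coe_ennreal_toReal htop,
    InformationTheory.toReal_klDiv_of_measure_eq hac (by simp), EReal.coe_le_coe_iff]
  simp only [probReal_univ] at hnonneg
  linarith

/-! ### The two sides of the duality. -/

lemma G_le_W_add_R (μ γ ν : Measure S) [IsProbabilityMeasure γ] [IsProbabilityMeasure ν] :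
    G c μ ν ≤ W c μ γ + R γ ν := by
  refine iSup₂_le fun g hg => ?_
  have h1 : ((∫ x, g x ∂μ - ∫ x, g x ∂γ : ℝ) : EReal) ≤ W c μ γ := le_iSup₂ (f := fun
    (g : S →ᵇ ℝ) (_ : g ∈ lipCb c) => ((∫ x, g x ∂μ - ∫ x, g x ∂γ : ℝ) : EReal)) g hg
  refine le_of_eq_of_le ?_ (add_le_add h1 (integral_sub_log_integral_exp_le_R (γ := γ) (ν := ν) g))
  rw [← EReal.coe_add]
  congr 1
  ring

/-- Unbounded members of `Lip(c, S)` are admissible in the supremum defining the divergence. -/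
lemma integral_sub_log_integral_exp_le_G {μ ν : Measure S} [IsProbabilityMeasure μ]
    [IsProbabilityMeasure ν] {f : C(S, ℝ)} (hf : f ∈ lipC c) (hint : Integrable (fun x => f x) μ)
    (hexp : Integrable (fun x => Real.exp (f x)) ν) :
    ((∫ x, f x ∂μ - Real.log (∫ x, Real.exp (f x) ∂ν) : ℝ) : EReal) ≤ G c μ ν := by
  have h1 : Tendsto (fun n : ℕ => ∫ x, truncate n n f x ∂μ) atTop (𝓝 (∫ x, f x ∂μ)) :=
    tendsto_integral_of_dominated_convergence (fun x => |f x|)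
      (fun n => (truncate n n f).continuous.measurable.aestronglyMeasurable) hint.abs
      (fun n => ae_of_all _ fun x => abs_truncate_le _ _ f x)
      (ae_of_all _ fun x => tendsto_truncate f x)
  have h2 : Tendsto (fun n : ℕ => ∫ x, Real.exp (truncate n n f x) ∂ν) atTop
      (𝓝 (∫ x, Real.exp (f x) ∂ν)) := by
    -- Clamping from below can raise `f`, but never above `0`; the `1 = e^0` covers this.
    refine tendsto_integral_of_dominated_convergence (fun x => Real.exp (f x) + 1)
      (fun n => (Real.continuous_exp.comp
        (truncate n n f).continuous).measurable.aestronglyMeasurable)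
      (hexp.add (integrable_const _)) (fun n => ae_of_all _ fun x => ?_)
      (ae_of_all _ fun x => (Real.continuous_exp.tendsto _).comp (tendsto_truncate f x))
    rw [Real.norm_of_nonneg (Real.exp_pos _).le]
    refine (Real.exp_le_exp.2 (truncate_le_max_zero _ _ f x)).trans ?_
    rcases max_choice (f x) 0 with h | h <;> rw [h]
    · linarith
    · rw [Real.exp_zero]; linarith [Real.exp_pos (f x)]
  have h3 := h1.sub (h2.log (integral_exp_pos hexp).ne')
  refine le_of_tendsto' ((continuous_coe_real_ereal.tendsto _).comp h3) fun n => ?_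
  exact le_iSup₂ (f := fun (g : S →ᵇ ℝ) (_ : g ∈ lipCb c) =>
    ((∫ x, g x ∂μ - Real.log (∫ x, Real.exp (g x) ∂ν) : ℝ) : EReal)) _
    (truncate_mem_lipCb hf n n)

/-- Finiteness of the transport cost bounds the truncated positive parts of a member of
`Lip(c, S)`. -/
lemma integral_truncate_le_of_W_eq (hsymm : ∀ x y, c x y = c y x) {μ γ : Measure S}
    [IsProbabilityMeasure μ] {f : C(S, ℝ)} (hf : f ∈ lipC c)
    (hint : Integrable (fun x => f x) μ) {w : ℝ} (hw : W c μ γ = w) (n : ℕ) :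
    ∫ x, truncate 0 n f x ∂γ ≤ w + ∫ x, |f x| ∂μ := by
  -- The negated truncation is tested because an upper bound under `γ` is wanted; symmetry of `c`
  -- makes it admissible.
  have h : ((∫ x, (-truncate 0 n f) x ∂μ - ∫ x, (-truncate 0 n f) x ∂γ : ℝ) : EReal) ≤ W c μ γ :=
    le_iSup₂ (f := fun (g : S →ᵇ ℝ) (_ : g ∈ lipCb c) =>
      ((∫ x, g x ∂μ - ∫ x, g x ∂γ : ℝ) : EReal)) _
      (neg_mem_lipCb hsymm (truncate_mem_lipCb hf 0 n))
  rw [hw, EReal.coe_le_coe_iff] at h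
  simp only [BoundedContinuousFunction.coe_neg, Pi.neg_apply, integral_neg] at h
  have h' : ∫ x, truncate 0 n f x ∂μ ≤ ∫ x, |f x| ∂μ :=
    integral_mono ((truncate 0 n f).integrable μ) hint.abs
      fun x => (le_abs_self _).trans (abs_truncate_le _ _ f x)
  linarith

end Measure

end GammaDivergence

theorem mainTheorem5 {S : Type*} [MetricSpace S] [PolishSpace S] [MeasurableSpace S] [BorelSpace S]
    (c : S → S → ℝ≥0∞)
    (hsymm : ∀ x y, c x y = c y x)
    (hrep : GammaDivergence.HasSupRepresentation c)
    (hdet : GammaDivergence.IsMeasureDetermining c)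
    (a : S → ℝ≥0)
    (hca : ∀ x y, c x y ≤ (a x : ℝ≥0∞) + (a y : ℝ≥0∞))
    (hmod : GammaDivergence.HasLocalModulus c)
    (μ ν : Measure S) [IsProbabilityMeasure μ] [IsProbabilityMeasure ν]
    (hμ : ∫⁻ x, (a x : ℝ≥0∞) ∂μ < ∞)
    (hν : ∫⁻ x, (a x : ℝ≥0∞) ∂ν < ∞)
    (g₁ : C(S, ℝ)) (hg₁ : g₁ ∈ GammaDivergence.lipC c)
    (γ₁ : Measure S) [IsProbabilityMeasure γ₁]
    (hac : γ₁ ≪ ν)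
    (hdens : γ₁.rnDeriv ν =ᵐ[ν]
      fun x => ENNReal.ofReal (Real.exp (g₁ x) / ∫ y, Real.exp (g₁ y) ∂ν))
    (hW : GammaDivergence.W c μ γ₁ = ((∫ x, g₁ x ∂μ - ∫ x, g₁ x ∂γ₁ : ℝ) : EReal)) :
    -- `g₁` attains the supremum defining the divergence
    (Integrable (fun x => g₁ x) μ ∧ Integrable (fun x => Real.exp (g₁ x)) ν ∧
      GammaDivergence.G c μ ν =
        ((∫ x, g₁ x ∂μ - Real.log (∫ x, Real.exp (g₁ x) ∂ν) : ℝ) : EReal)) ∧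
    -- `γ₁` attains the infimum, whose value is the divergence
    GammaDivergence.G c μ ν = GammaDivergence.W c μ γ₁ + GammaDivergence.R γ₁ ν ∧
    (⨅ γ : ProbabilityMeasure S,
        (GammaDivergence.W c μ (γ : Measure S) + GammaDivergence.R (γ : Measure S) ν)) =
      GammaDivergence.W c μ γ₁ + GammaDivergence.R γ₁ ν := by
  have hint := GammaDivergence.integrable_of_mem_lipC hca hμ hg₁
  obtain ⟨hexp, rfl⟩ := GammaDivergence.eq_tilted_of_rnDeriv hac hdens
  -- `hW` serves here only to say that `W` is a real number, so no integrability is presupposed.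
  have hint' := GammaDivergence.integrable_tilted_self hexp
    (GammaDivergence.integral_truncate_le_of_W_eq hsymm hg₁ hint hW)
  have hWR : GammaDivergence.W c μ (ν.tilted g₁) + GammaDivergence.R (ν.tilted g₁) ν =
      ((∫ x, g₁ x ∂μ - Real.log (∫ x, Real.exp (g₁ x) ∂ν) : ℝ) : EReal) := by
    rw [hW, GammaDivergence.R_tilted_self hexp hint', ← EReal.coe_add]
    congr 1
    ring
  have hG : GammaDivergence.G c μ ν =
      ((∫ x, g₁ x ∂μ - Real.log (∫ x, Real.exp (g₁ x) ∂ν) : ℝ) : EReal) :=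
    le_antisymm (hWR ▸ GammaDivergence.G_le_W_add_R μ (ν.tilted g₁) ν)
      (GammaDivergence.integral_sub_log_integral_exp_le_G hg₁ hint hexp)
  refine ⟨⟨hint, hexp, hG⟩, hG.trans hWR.symm, le_antisymm ?_ ?_⟩
  · exact iInf_le (fun γ : ProbabilityMeasure S =>
      GammaDivergence.W c μ (γ : Measure S) + GammaDivergence.R (γ : Measure S) ν)
      ⟨ν.tilted g₁, inferInstance⟩
  · rw [hWR, ← hG]
    exact le_iInf fun γ => GammaDivergence.G_le_W_add_R μ (γ : Measure S) ν
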